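/- Let $m,n\ge 0$, $d=2^n$, $d'=2^m$. Represent pure $n$-qubit states as points of the unit sphere $S^{2d-1}$ of $\mathbb{C}^{d}\cong\mathbb{R}^{2d}$, and for a random state $X$ and a fixed error-free state $\Phi$ put $F^2(X)=E\left[|\langle X|\Phi\rangle|^2\right]$. Let $\mathcal{C}$ be an $(n,m)$-quantum code, that is, an isometric encoding $\mathbb{C}^{d'}\to\mathbb{C}^{d}$ with image $C$, together with $d''$ discrete errors (unitary operators) $E_0=I,E_1,\dots,E_{d''-1}$ on $\mathbb{C}^{d}$ such that the subspaces $E_jC$ are pairwise orthogonal and $d=d'd''$. Let $\Pi_j$ be the orthogonal projection onto $E_jC$. The corrector circuit of $\mathcal{C}$, assumed ideal, measures the syndrome of a state $\psi$, obtaining $j$ with probability $P_j=\|\Pi_j\psi\|^2$, and then outputs $E_j^{-1}\Pi_j\psi/\|\Pi_j\psi\|$. Let $\Phi$ be the $\mathcal{C}$-encoding of a pure $m$-qubit state $\Phi_0$. Suppose that $\Phi$ is changed by an isotropic error into the random state $\Psi$: the law of $\Psi$ on $S^{2d-1}$ has, with respect to the surface measure, a density $f(\theta_0)$ that depends only on the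 polar angle $\theta_0\in[0,\pi]$ given by $\cos\theta_0=\operatorname{Re}\langle\Phi|\Psi\rangle$. Let $\tilde\Phi$ be the random state which the corrector circuit of $\mathcal{C}$ outputs when it is applied to $\Psi$. Then $$F^2(\tilde\Phi)\ \ge\ F^2(\Psi).$$ -/

import Mathlib

open MeasureTheory ProbabilityTheory
open scoped ENNReal

/-- The Hilbert space `ℂ^(2^n)` of `n`-qubits; as a real Euclidean space it is `ℝ^(2d)`, `d = 2^n`. -/
abbrev QubitSpace (n : ℕ) : Type := EuclideanSpace ℂ (Fin (2 ^ n))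

/-- Pure `n`-qubit states: the points of the unit sphere `S^(2d-1)`. -/
abbrev QState (n : ℕ) : Type := Metric.sphere (0 : QubitSpace n) 1

noncomputable section

/-- The surface measure of the sphere `S^(2d-1)` of `n`-qubit states. -/
def surfaceMeasure (n : ℕ) : Measure (QState n) :=
  (volume : Measure (QubitSpace n)).toSphere

/-- The polar angle `θ₀ ∈ [0, π]` of `x` with respect to the pole `Φ`: if `Φ = |0⟩` and
`x = (x₀ + i x₁, …)` then `x₀ = cos θ₀`. -/
def polarAngle {n : ℕ} (Φ x : QState n) : ℝ :=
  Real.arccos (inner ℂ (Φ : QubitSpace n) (x : QubitSpace n)).re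

/-- The law `μ` of a random state is isotropic around `Φ`, with density `f(θ₀)` with respect to
the surface measure. -/
structure IsIsotropic {n : ℕ} (Φ : QState n) (f : ℝ → ℝ) (μ : Measure (QState n)) : Prop where
  measurable_density : Measurable f
  density_nonneg : ∀ θ ∈ Set.Icc 0 Real.pi, 0 ≤ f θ
  law_eq : μ = (surfaceMeasure n).withDensity fun x => ENNReal.ofReal (f (polarAngle Φ x))

/-- The squared fidelity `F²(X) = E[|⟨X|Φ⟩|²]` of a random state `X` with law `μ`, relative to the
error-free state `Φ`. -/
def sqFidelity {n : ℕ} (Φ : QState n) (μ : Measure (QState n)) : ℝ :=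
  ∫ x, ‖inner ℂ (x : QubitSpace n) (Φ : QubitSpace n)‖ ^ 2 ∂μ

/-- An `(n, m)`-quantum code: an isometric encoding of `m`-qubits as `n`-qubits, with image the code
space of dimension `d' = 2^m`, together with the `d''` discrete errors `E₀ = I, E₁, …` which it
corrects. These are unitary operators which take the code space to pairwise orthogonal subspaces,
and these subspaces exhaust the `n`-qubit space: `d = d' d''`. -/
structure QuantumCode (n m : ℕ) where
  encode : QubitSpace m →ₗᵢ[ℂ] QubitSpace n
  numErrors : ℕ
  dim_eq : 2 ^ n = 2 ^ m * numErrors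
  discreteError : Fin numErrors → (QubitSpace n ≃ₗᵢ[ℂ] QubitSpace n)
  discreteError_zero : ∀ j : Fin numErrors, (j : ℕ) = 0 →
    discreteError j = LinearIsometryEquiv.refl ℂ (QubitSpace n)
  orthogonal : ∀ i j : Fin numErrors, i ≠ j → ∀ u v : QubitSpace m,
    inner ℂ (discreteError i (encode u)) (discreteError j (encode v)) = 0

/-- The state `v / ‖v‖`, with the convention that it is `default` if `v = 0`. -/
def normalizeState {n : ℕ} (default : QState n) (v : QubitSpace n) : QState n :=
  ⟨if v = 0 then (default : QubitSpace n) else ((‖v‖⁻¹ : ℝ) : ℂ) • v, by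
    split_ifs with h
    · exact default.2
    · have h2 : ‖v‖ ≠ 0 := norm_ne_zero_iff.mpr h
      simp [norm_smul, h2]⟩

lemma measurable_normalizeState {n : ℕ} {g : QState n → QubitSpace n} (hg : Measurable g) :
    Measurable fun ψ => normalizeState ψ (g ψ) := by
  refine Measurable.subtype_mk ?_
  refine Measurable.ite (hg (measurableSet_singleton 0)) measurable_subtype_coe ?_
  exact (Complex.measurable_ofReal.comp hg.norm.inv).smul hg

namespace QuantumCode

variable {n m : ℕ} (C : QuantumCode n m)

/-- The encoded state `Φ` of the `m`-qubit `Φ₀`. -/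
def encodeState (Φ₀ : QState m) : QState n :=
  ⟨C.encode (Φ₀ : QubitSpace m), by simp⟩

/-- The subspace `E_j C`, on which the syndrome `j` is measured. -/
def syndromeSpace (j : Fin C.numErrors) : Submodule ℂ (QubitSpace n) :=
  (LinearMap.range C.encode.toLinearMap).map (C.discreteError j).toLinearEquiv.toLinearMap

/-- The orthogonal projection `Π_j` onto `E_j C`. -/
def syndromeProj (j : Fin C.numErrors) : QubitSpace n →L[ℂ] QubitSpace n :=
  (C.syndromeSpace j).starProjection

/-- The probability `P_j = ‖Π_j ψ‖²` of measuring the syndrome `j` in the state `ψ`. -/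
def syndromeProb (j : Fin C.numErrors) (ψ : QState n) : ℝ≥0∞ :=
  ENNReal.ofReal (‖C.syndromeProj j (ψ : QubitSpace n)‖ ^ 2)

/-- The final state `E_j⁻¹ Π_j ψ / ‖Π_j ψ‖` of the corrector circuit when it has measured the
syndrome `j` (the value for `Π_j ψ = 0` is irrelevant, as this happens with probability `0`). -/
def correctedState (j : Fin C.numErrors) (ψ : QState n) : QState n :=
  normalizeState ψ ((C.discreteError j).symm (C.syndromeProj j (ψ : QubitSpace n)))

/-- The ideal corrector circuit of the code, as a Markov kernel: applied to `ψ`, it measures the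
syndrome and outputs `correctedState j ψ` with probability `syndromeProb j ψ`. -/
def corrector : Kernel (QState n) (QState n) where
  toFun ψ := ∑ j, C.syndromeProb j ψ • Measure.dirac (C.correctedState j ψ)
  measurable' := by
    have hp (j : Fin C.numErrors) : Measurable fun ψ : QState n =>
        C.syndromeProj j (ψ : QubitSpace n) :=
      (C.syndromeProj j).continuous.measurable.comp measurable_subtype_coe
    have hs (j : Fin C.numErrors) : Measurable fun ψ : QState n => C.correctedState j ψ :=
      measurable_normalizeState ((C.discreteError j).symm.continuous.measurable.comp (hp j))
    refine Measure.measurable_of_measurable_coe _ fun s hms => ?_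
    simp only [Measure.coe_finsetSum, Finset.sum_apply, Measure.smul_apply, smul_eq_mul]
    refine Finset.measurable_sum _ fun j _ => ?_
    exact (((hp j).norm.pow_const 2).ennreal_ofReal).mul
      (((Measure.measurable_coe hms).comp Measure.measurable_dirac).comp (hs j))

/-- The law of the corrected state `Φ̃`, where `μ` is the law of the disturbed state `Ψ`. -/
def correctedLaw (μ : Measure (QState n)) : Measure (QState n) :=
  μ.bind C.corrector

end QuantumCode

end

/-! The inequality holds pointwise in the disturbed state `ψ`. Syndrome `j` contributes its
probability times the fidelity of the normalized output; the probability `‖Π_j ψ‖²` cancels the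
normalization, and since `E_j Φ` lies in `E_j C` the projection can be dropped, leaving `|⟨ψ|E_j
Φ⟩|²` (`syndromeProb_mul_fidelity`). The corrected state thus has squared fidelity `E[∑ j, |⟨Ψ|E_j
Φ⟩|²]` (`lintegral_correctedLaw`). As `E₀ = I`, the term `j = 0` is already the fidelity of `Ψ`, and
the other terms are nonnegative. -/

theorem inner_starProjection_eq_of_mem {𝕜 E : Type*} [RCLike 𝕜] [NormedAddCommGroup E]
    [InnerProductSpace 𝕜 E] (K : Submodule 𝕜 E) [K.HasOrthogonalProjection] {v : E} (hv : v ∈ K)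
    (u : E) : inner 𝕜 (K.starProjection u) v = inner 𝕜 u v := by
  rw [K.inner_starProjection_left_eq_right, K.starProjection_eq_self_iff.mpr hv]

/-- For `v = 0` both sides vanish, so the default state `ψ` plays no role. -/
theorem norm_sq_mul_norm_inner_normalizeState_sq {n : ℕ} (ψ : QState n) (v w : QubitSpace n) :
    ‖v‖ ^ 2 * ‖inner ℂ (normalizeState ψ v : QubitSpace n) w‖ ^ 2 = ‖inner ℂ v w‖ ^ 2 := by
  by_cases h : v = 0
  · simp [h]
  · have h2 : ‖v‖ ≠ 0 := norm_ne_zero_iff.mpr h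
    simp only [normalizeState, h, if_false, inner_smul_left, norm_mul, RCLike.norm_conj,
      Complex.norm_real, norm_inv, norm_norm]
    field_simp

theorem norm_inner_sq_le_one {n : ℕ} (x Φ : QState n) :
    ‖inner ℂ (x : QubitSpace n) (Φ : QubitSpace n)‖ ^ 2 ≤ 1 := by
  have h := norm_inner_le_norm (𝕜 := ℂ) (x : QubitSpace n) (Φ : QubitSpace n)
  rw [norm_eq_of_mem_sphere, norm_eq_of_mem_sphere, one_mul] at h
  exact pow_le_one₀ (norm_nonneg _) h

theorem continuous_norm_inner_sq {n : ℕ} (Φ : QState n) :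
    Continuous fun x : QState n => ‖inner ℂ (x : QubitSpace n) (Φ : QubitSpace n)‖ ^ 2 := by
  fun_prop

theorem measurable_ofReal_norm_inner_sq {n : ℕ} (Φ : QState n) :
    Measurable fun x : QState n =>
      ENNReal.ofReal (‖inner ℂ (x : QubitSpace n) (Φ : QubitSpace n)‖ ^ 2) :=
  (continuous_norm_inner_sq Φ).measurable.ennreal_ofReal

/-- Lower integrals pass through `Measure.bind` without integrability conditions. -/
theorem sqFidelity_eq_toReal_lintegral {n : ℕ} (Φ : QState n) (μ : Measure (QState n)) :
    sqFidelity Φ μ = (∫⁻ x, ENNReal.ofReal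
      (‖inner ℂ (x : QubitSpace n) (Φ : QubitSpace n)‖ ^ 2) ∂μ).toReal :=
  integral_eq_lintegral_of_nonneg_ae (.of_forall fun _ => sq_nonneg _)
    (continuous_norm_inner_sq Φ).aestronglyMeasurable

namespace QuantumCode

variable {n m : ℕ} (C : QuantumCode n m)

theorem numErrors_pos : 0 < C.numErrors := by
  refine Nat.pos_of_ne_zero fun h => ?_
  have := C.dim_eq
  simp [h] at this

theorem discreteError_encode_mem (j : Fin C.numErrors) (u : QubitSpace m) :
    C.discreteError j (C.encode u) ∈ C.syndromeSpace j :=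
  ⟨C.encode u, ⟨u, rfl⟩, rfl⟩

/-- The contribution of the syndrome `j` to the squared fidelity of the corrected state is the
squared overlap of `ψ` with the state `E_j Φ`. -/
theorem syndromeProb_mul_fidelity (Φ₀ : QState m) (j : Fin C.numErrors) (ψ : QState n) :
    C.syndromeProb j ψ * ENNReal.ofReal
      (‖inner ℂ (C.correctedState j ψ : QubitSpace n) (C.encodeState Φ₀ : QubitSpace n)‖ ^ 2) =
    ENNReal.ofReal (‖inner ℂ (ψ : QubitSpace n)
      (C.discreteError j (C.encodeState Φ₀ : QubitSpace n))‖ ^ 2) := by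
  have hproj : inner ℂ ((C.discreteError j).symm (C.syndromeProj j (ψ : QubitSpace n)))
      (C.encodeState Φ₀ : QubitSpace n) = inner ℂ (ψ : QubitSpace n)
        (C.discreteError j (C.encodeState Φ₀ : QubitSpace n)) := by
    -- Applying the unitary `E_j` to both arguments cancels `E_j⁻¹` and turns `Φ` into `E_j Φ`,
    -- which `Π_j` fixes.
    rw [← (C.discreteError j).inner_map_map, LinearIsometryEquiv.apply_symm_apply]
    exact inner_starProjection_eq_of_mem _ (C.discreteError_encode_mem j Φ₀) _
  -- `E_j⁻¹` preserves norms, so `P_j` is also the squared norm of the vector being normalized.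
  rw [syndromeProb, ← ENNReal.ofReal_mul (sq_nonneg _), correctedState, ← hproj,
    ← norm_sq_mul_norm_inner_normalizeState_sq ψ ((C.discreteError j).symm _),
    LinearIsometryEquiv.norm_map]

theorem lintegral_corrector (Φ₀ : QState m) (ψ : QState n) :
    ∫⁻ x, ENNReal.ofReal (‖inner ℂ (x : QubitSpace n) (C.encodeState Φ₀ : QubitSpace n)‖ ^ 2)
      ∂C.corrector ψ =
    ∑ j, ENNReal.ofReal (‖inner ℂ (ψ : QubitSpace n)
      (C.discreteError j (C.encodeState Φ₀ : QubitSpace n))‖ ^ 2) := by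
  change ∫⁻ x, _ ∂(∑ j, C.syndromeProb j ψ • Measure.dirac (C.correctedState j ψ)) = _
  rw [lintegral_finsetSum_measure]
  refine Finset.sum_congr rfl fun j _ => ?_
  rw [lintegral_smul_measure, lintegral_dirac' _ (measurable_ofReal_norm_inner_sq _), smul_eq_mul,
    C.syndromeProb_mul_fidelity]

/-- The squared fidelity of the corrected state is the expectation of `∑ j, |⟨Ψ|E_j Φ⟩|²`. -/
theorem lintegral_correctedLaw (Φ₀ : QState m) (μ : Measure (QState n)) :
    ∫⁻ x, ENNReal.ofReal (‖inner ℂ (x : QubitSpace n) (C.encodeState Φ₀ : QubitSpace n)‖ ^ 2)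
      ∂C.correctedLaw μ =
    ∫⁻ ψ, ∑ j, ENNReal.ofReal (‖inner ℂ (ψ : QubitSpace n)
      (C.discreteError j (C.encodeState Φ₀ : QubitSpace n))‖ ^ 2) ∂μ := by
  rw [correctedLaw, Measure.lintegral_bind C.corrector.measurable.aemeasurable
    (measurable_ofReal_norm_inner_sq _).aemeasurable]
  exact lintegral_congr fun ψ => C.lintegral_corrector Φ₀ ψ

/-- Needed because `toReal` is monotone only below `∞`. Each overlap of unit vectors is at most `1`,
so the integrand is at most `numErrors`. -/
theorem lintegral_correctedLaw_ne_top (Φ₀ : QState m) (μ : Measure (QState n))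
    [IsFiniteMeasure μ] :
    ∫⁻ x, ENNReal.ofReal (‖inner ℂ (x : QubitSpace n) (C.encodeState Φ₀ : QubitSpace n)‖ ^ 2)
      ∂C.correctedLaw μ ≠ ∞ := by
  rw [lintegral_correctedLaw]
  refine ((lintegral_mono (g := fun _ => ∑ _j : Fin C.numErrors, 1) fun ψ =>
    Finset.sum_le_sum fun j _ => ?_).trans_lt ?_).ne
  · exact ENNReal.ofReal_le_one.mpr (norm_inner_sq_le_one ψ
      ⟨C.discreteError j (C.encodeState Φ₀ : QubitSpace n), by simp⟩)
  · rw [lintegral_const]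
    exact ENNReal.mul_lt_top (by simp) (measure_lt_top _ _)

end QuantumCode

theorem mainTheorem3 (n m : ℕ) (C : QuantumCode n m) (Φ₀ : QState m) (f : ℝ → ℝ)
    (μ : Measure (QState n)) [IsProbabilityMeasure μ]
    (hμ : IsIsotropic (C.encodeState Φ₀) f μ) :
    sqFidelity (C.encodeState Φ₀) (C.correctedLaw μ) ≥ sqFidelity (C.encodeState Φ₀) μ := by
  rw [ge_iff_le, sqFidelity_eq_toReal_lintegral, sqFidelity_eq_toReal_lintegral]
  refine ENNReal.toReal_mono (C.lintegral_correctedLaw_ne_top Φ₀ μ) ?_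
  rw [C.lintegral_correctedLaw]
  refine lintegral_mono fun ψ => ?_
  -- Keep only the trivial error `E₀ = I`.
  have h := Finset.single_le_sum (f := fun j => ENNReal.ofReal (‖inner ℂ (ψ : QubitSpace n)
      (C.discreteError j (C.encodeState Φ₀ : QubitSpace n))‖ ^ 2))
    (fun _ _ => zero_le) (Finset.mem_univ (⟨0, C.numErrors_pos⟩ : Fin C.numErrors))
  simpa only [C.discreteError_zero ⟨0, C.numErrors_pos⟩ rfl, LinearIsometryEquiv.coe_refl, id]
    using h
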